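/- Consider a primary link and a secondary (SU) link. Fix an integer $L\ge 2$ and reals $0<\lambda<1$, $\theta_p,\theta_s,P_p,P_{\max},\sigma^2>0$, and put $\gamma_p=P_p/\sigma^2$, $\gamma_{\max}=P_{\max}/\sigma^2$. Let $\mathcal{CN}(0,v)$ be the circularly symmetric complex Gaussian law of variance $v$. Model. The primary channel $h_p$ is $\mathcal{CN}(0,1)$; the channel $\mathbf h_x\in\mathbb C^L$ from the SU transmitter to the primary receiver has i.i.d. $\mathcal{CN}(0,\lambda)$ entries; the SU channel $\mathbf h_s\in\mathbb C^L$ has i.i.d. $\mathcal{CN}(0,1)$ entries. Write $g_p=|h_p|^2$, $g_x=\|\mathbf h_x\|^2/\lambda$, $g_s=\|\mathbf h_s\|^2$, $\mathbf s_x=\mathbf h_x/\|\mathbf h_x\|$, $\mathbf s_s=\mathbf h_s/\|\mathbf h_s\|$. The direction $\mathbf s_x$ is quantized with $B\in\{0,1,2,\dots\}$ bits to a random unit vector $\hat{\mathbf s}_x$ whose error $\epsilon=1-|\hat{\mathbf s}_x^\dagger\mathbf s_x|^2$ satisfies $\Pr(\epsilon\le\tau)=2^B\tau^{L-1}$ for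 $0\le\tau\le 2^{-B/(L-1)}$ (and $\Pr(\epsilon\le\tau)=1$ for larger $\tau$). The gain $g_x$ is independent of $(\mathbf s_x,\hat{\mathbf s}_x)$, and $(\mathbf h_x,\hat{\mathbf s}_x)$, $\mathbf h_s$, $h_p$ are mutually independent. Orthogonal cognitive beamforming (OCB) with feedforward and perfect power-control feedback. Let $\hat{\mathbf s}_\perp$ be the normalized component of $\mathbf s_s$ orthogonal to $\hat{\mathbf s}_x$, $\delta=|\mathbf s_x^\dagger\hat{\mathbf s}_\perp|^2$ and $\omega=\sigma^2(\gamma_pg_p/\theta_p-1)$. The power budget is $\acute P_s=\min\{\omega/(\lambda g_x\delta),P_{\max}\}$ if $\omega\ge0$ and $\acute P_s=P_{\max}$ if $\omega<0$. The beamformer $\mathbf f$ maximizes $|\mathbf f^\dagger\mathbf s_s|^2$ subject to $\mathbf f^\dagger\hat{\mathbf s}_x=0$ and $\|\mathbf f\|^2\le\acute P_s$. The SU outage probability is $$\acute P_{\rm out}=\Pr\left(\frac{g_s}{\sigma^2}|\mathbf f^\dagger\mathbf s_s|^2\le\theta_s\right).$$ Theorem. With $\Gamma(s,x)=\int_x^\infty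 t^{s-1}e^{-t}\,dt$, $$\acute P_{\rm out}=1-\frac{\Gamma\left(L-1,\frac{\theta_s}{\gamma_{\max}}\right)}{\Gamma(L-1)}+\frac{\varphi}{L-1}\,2^{-\frac{B}{L-1}}+O\left(2^{-\frac{2B}{L-1}}\right),\qquad \varphi=e^{-\frac{\theta_p}{\gamma_p}}\,\frac{(L-1)\lambda\theta_p\theta_s\,\Gamma\left(L-2,\frac{\theta_s}{\gamma_{\max}}\right)}{\gamma_p\,\Gamma(L-1)},$$ where the implied constant depends only on $L,\lambda,\theta_p,\theta_s,P_p,P_{\max},\sigma^2$, and not on $B$. -/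

import Mathlib

open MeasureTheory ProbabilityTheory

noncomputable section

namespace CognitiveBeamforming

/-- The upper incomplete gamma function `Γ(s, x) = ∫_x^∞ t^(s-1) e^(-t) dt` (for `x > 0`). -/
def upperGamma (s x : ℝ) : ℝ := ∫ t in Set.Ioi x, t ^ (s - 1) * Real.exp (-t)

/-- The circularly symmetric complex Gaussian law `CN(0, v)`: real and imaginary parts are
independent real centred Gaussians of variance `v / 2`. -/
def complexGaussian (v : ℝ) : Measure ℂ :=
  ((gaussianReal 0 (v / 2).toNNReal).prod (gaussianReal 0 (v / 2).toNNReal)).map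
    Complex.measurableEquivRealProd.symm

/-- Vectors in `ℂ^L` with the Euclidean norm.
Note that `inner ℂ u v` is `u† v` (conjugate-linear in `u`). -/
abbrev CVec (L : ℕ) : Type := EuclideanSpace ℂ (Fin L)

/-- The direction `h / ‖h‖` of a vector. -/
def shape {L : ℕ} (h : CVec L) : CVec L := ((‖h‖⁻¹ : ℝ) : ℂ) • h

/-- The random vector `h` has i.i.d. `CN(0, v)` entries. -/
def IsIIDComplexGaussian {Ω : Type*} [MeasurableSpace Ω] {L : ℕ} (μ : Measure Ω)
    (v : ℝ) (h : Ω → CVec L) : Prop :=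
  iIndepFun (fun (i : Fin L) (ω : Ω) => h ω i) μ ∧
    ∀ i, HasLaw (fun ω => h ω i) (complexGaussian v) μ

/-- The deterministic parameters of the system. -/
structure Params where
  /-- number of antennas at the secondary transmitter -/
  L : ℕ
  /-- relative path loss of the cross link -/
  lam : ℝ
  /-- SINR threshold of the primary receiver -/
  thetaP : ℝ
  /-- SNR threshold of the secondary receiver -/
  thetaS : ℝ
  /-- primary transmission power -/
  Pp : ℝ
  /-- maximal secondary transmission power -/
  Pmax : ℝ
  /-- noise power `σ²` -/
  noise : ℝ

namespace Params

/-- The primary transmit SNR. -/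
def gammaP (p : Params) : ℝ := p.Pp / p.noise

/-- The maximal secondary transmit SNR. -/
def gammaMax (p : Params) : ℝ := p.Pmax / p.noise

/-- The coefficient of the quantization term for beamforming without feedforward. -/
def phi (p : Params) : ℝ :=
  Real.exp (-(p.thetaP / p.gammaP)) *
    ((((p.L : ℝ) - 1) * p.lam * p.thetaP * p.thetaS *
        upperGamma ((p.L : ℝ) - 2) (p.thetaS / p.gammaMax)) /
      (p.gammaP * Real.Gamma ((p.L : ℝ) - 1)))

end Params

/-- The quantization error `ε = 1 - |ŝ† s|²` of the channel direction `s`. -/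
def cdiError {L : ℕ} (sHat s : CVec L) : ℝ := 1 - ‖inner ℂ sHat s‖ ^ 2

/-- The distribution function of the quantization error with `B` feedback bits. -/
def cdiErrorCDF (L B : ℕ) (τ : ℝ) : ℝ :=
  if τ < 0 then 0
  else if τ ≤ (2 : ℝ) ^ (-((B : ℝ) / ((L : ℝ) - 1))) then (2 : ℝ) ^ B * τ ^ (L - 1)
  else 1

/-- The unit vector `ŝ_⊥ ⟂ ŝ` in the decomposition `s_s = a ŝ + b ŝ_⊥` (for a unit vector `ŝ`). -/
def perpDir {L : ℕ} (sHat ss : CVec L) : CVec L := shape (ss - (inner ℂ sHat ss : ℂ) • sHat)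

/-- `ω = σ² (γ_p g_p / θ_p - 1)`, the interference margin of the primary receiver. -/
def margin (p : Params) (gp : ℝ) : ℝ := p.noise * (p.gammaP * gp / p.thetaP - 1)

/-- The unquantized interference power control signal with feedforward: `ω / (λ g_x δ)` if
`ω ≥ 0`, and `P_max` otherwise, where `g_x = ‖h_x‖² / λ` and `δ = |s_x† ŝ_⊥|²`.
(The denominator vanishes only on an event of probability zero.) -/
def ipcFeedforward (p : Params) (hp : ℂ) (hx sHat hs : CVec p.L) : ℝ :=
  let gp := ‖hp‖ ^ 2
  let gx := ‖hx‖ ^ 2 / p.lam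
  let δ := ‖inner ℂ (shape hx) (perpDir sHat (shape hs))‖ ^ 2
  if 0 ≤ margin p gp then margin p gp / (p.lam * gx * δ) else p.Pmax

/-- The power budget of the secondary transmitter: the perfectly fed back power control signal,
capped at `P_max`. -/
def powerBudget (p : Params) (hp : ℂ) (hx sHat hs : CVec p.L) : ℝ :=
  min (ipcFeedforward p hp hx sHat hs) p.Pmax

/-- `f` is an orthogonal cognitive beamformer: it maximizes `|f† s_s|²` subject to `f† ŝ = 0` and
`‖f‖² ≤ P`. -/
def IsOCB {L : ℕ} (sHat ss : CVec L) (P : ℝ) (f : CVec L) : Prop :=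
  f ∈ {v : CVec L | inner ℂ v sHat = 0 ∧ ‖v‖ ^ 2 ≤ P} ∧
    IsMaxOn (fun v : CVec L => ‖inner ℂ v ss‖ ^ 2)
      {v : CVec L | inner ℂ v sHat = 0 ∧ ‖v‖ ^ 2 ≤ P} f

/-- The receive SNR of the secondary link, `(g_s / σ²) |f† s_s|²` with `g_s = ‖h_s‖²`. -/
def snrS (p : Params) (hs f : CVec p.L) : ℝ :=
  ‖hs‖ ^ 2 / p.noise * ‖inner ℂ f (shape hs)‖ ^ 2

/-- Orthogonal cognitive beamforming with feedforward, `B` bits of channel-direction feedback and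
perfect power-control feedback.  Here `hp`, `hx`, `hs` are the primary channel, the channel from the
secondary transmitter to the primary receiver and the channel of the secondary link, `sHat` is the
quantized direction of `hx` and `f` the beamformer. -/
structure IsOCBFeedforward {Ω : Type*} [MeasurableSpace Ω] (μ : Measure Ω) (p : Params) (B : ℕ)
    (hp : Ω → ℂ) (hx hs sHat f : Ω → CVec p.L) : Prop where
  law_hp : HasLaw hp (complexGaussian 1) μ
  law_hx : IsIIDComplexGaussian μ p.lam hx
  law_hs : IsIIDComplexGaussian μ 1 hs
  aemeasurable_sHat : AEMeasurable sHat μ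
  norm_sHat : ∀ᵐ ω ∂μ, ‖sHat ω‖ = 1
  cdf_cdiError : ∀ τ : ℝ,
    μ.real {ω | cdiError (sHat ω) (shape (hx ω)) ≤ τ} = cdiErrorCDF p.L B τ
  /-- The quantizer acts on the direction of `hx` only. -/
  indep_gain : IndepFun (fun ω => ‖hx ω‖) (fun ω => (shape (hx ω), sHat ω)) μ
  indep_hs : IndepFun (fun ω => (hx ω, sHat ω)) hs μ
  indep_hp : IndepFun (fun ω => ((hx ω, sHat ω), hs ω)) hp μ
  beamformer : ∀ᵐ ω ∂μ, IsOCB (sHat ω) (shape (hs ω))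
    (powerBudget p (hp ω) (hx ω) (sHat ω) (hs ω)) (f ω)

/-- The outage probability of the secondary link. -/
def outageProb {Ω : Type*} [MeasurableSpace Ω] (μ : Measure Ω) (p : Params)
    (hs f : Ω → CVec p.L) : ℝ :=
  μ.real {ω | snrS p (hs ω) (f ω) ≤ p.thetaS}

end CognitiveBeamforming

end

noncomputable section

namespace CognitiveBeamforming

open Module (finrank)
open scoped Real

attribute [local instance] InnerProductSpace.complexToReal

/-! ### Standard complex Gaussian vectors: invariance and radial moments. -/

section Gaussian

/-! Write `h⊥` for the component of `h_s` orthogonal to `ŝ_x`, and put `t = θ_p/γ_p`, `a =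
θ_s/γ_max`, `τ = 2^(-B/(L-1))`. By Cauchy–Schwarz the best beam lies along `h⊥`, so a power budget
`P` yields the SNR `P‖h⊥‖²/σ²` (`IsOCB.normSq_inner`). Up to a null set, outage therefore means
`‖h⊥‖² ≤ a` (failure even at full power) or `t ≤ g_p ≤ t + y`, where `y = t θ_s λ g_x |s_x† h⊥|² /
‖h⊥‖⁴` (`snrS_le_iff`).

The gain `g_p` is exponential and independent of the rest, so on `‖h⊥‖² > a` the conditional outage
probability is `e^{-t}(1 - e^{-y}) = e^{-t}(y + O(y²))`. Given `ŝ_x`, `h⊥` is standard Gaussian on a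
space of complex dimension `L - 1`, so `‖h⊥‖²` has the Gamma law of shape `L - 1`; this gives the
term free of `B`. In the linear term only the part of `s_x` orthogonal to `ŝ_x` counts, and its
squared norm is `ε`. Averaging over the direction of `h⊥` turns `|s_x† h⊥|²` into `ε‖h⊥‖²/(L-1)`
(`integral_inner_perp`), and independence gives `E[g_x ε] = (L-1)τ` (`integral_gain_mul_cdiError`);
together these produce `φ`.

Since `ε ≤ τ` almost surely, `y` is at most a constant times `g_x τ / a`. As `E[g_x²]` is finite and
free of `B`, the quadratic remainder is `O(τ²)` uniformly in `B` (`abs_real_outageSet_sub_le`). -/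

lemma finrank_real_div_two {E : Type*} [NormedAddCommGroup E] [InnerProductSpace ℂ E] :
    (finrank ℝ E : ℝ) / 2 = finrank ℂ E := by
  rw [finrank_real_of_complex]; push_cast; ring

variable (E : Type*) [NormedAddCommGroup E] [InnerProductSpace ℂ E] [FiniteDimensional ℂ E]
  [MeasurableSpace E] [BorelSpace E]

instance finiteDimensional_real_of_complex : FiniteDimensional ℝ E :=
  FiniteDimensional.complexToReal E

/-- The law on a finite-dimensional complex inner product space whose coordinates in any
orthonormal basis are independent and `CN(0, 1)`. -/
def standardGaussian : Measure E :=
  volume.withDensity fun x => ENNReal.ofReal ((π ^ finrank ℂ E)⁻¹ * Real.exp (-‖x‖ ^ 2))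

variable {E}

instance isProbabilityMeasure_standardGaussian : IsProbabilityMeasure (standardGaussian E) := by
  have h1 := GaussianFourier.integral_rexp_neg_mul_sq_norm (V := E) (b := 1) one_pos
  simp only [neg_mul, one_mul, div_one, finrank_real_div_two, Real.rpow_natCast] at h1
  have hpos : 0 < π ^ finrank ℂ E := by positivity
  have hInt : Integrable (fun x : E => Real.exp (-‖x‖ ^ 2)) := by
    by_contra h
    rw [integral_undef h] at h1
    exact hpos.ne h1
  constructor
  rw [standardGaussian, withDensity_apply _ MeasurableSet.univ, Measure.restrict_univ,
    ← ofReal_integral_eq_lintegral_ofReal (hInt.const_mul _)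
      (Filter.Eventually.of_forall fun x => by positivity),
    integral_const_mul, h1, inv_mul_cancel₀ hpos.ne', ENNReal.ofReal_one]

lemma integral_standardGaussian {F : Type*} [NormedAddCommGroup F] [NormedSpace ℝ F] (g : E → F) :
    ∫ x, g x ∂standardGaussian E
      = ∫ x, ((π ^ finrank ℂ E)⁻¹ * Real.exp (-‖x‖ ^ 2)) • g x := by
  rw [standardGaussian, integral_withDensity_eq_integral_toReal_smul (by fun_prop) (by simp)]
  refine integral_congr_ae (Filter.Eventually.of_forall fun x => ?_)
  simp only
  rw [ENNReal.toReal_ofReal (by positivity)]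

/-- Each real coordinate has variance 1/2, whence the 4 instead of the usual 2. -/
lemma charFun_standardGaussian (t : E) :
    charFun (standardGaussian E) t = Complex.exp (-‖t‖ ^ 2 / 4) := by
  have h := GaussianFourier.integral_cexp_neg_mul_sq_norm_add (V := E) (b := 1) (by simp)
    Complex.I t
  have h2 : (finrank ℝ E : ℂ) / 2 = (finrank ℂ E : ℂ) := by
    rw [finrank_real_of_complex]; push_cast; ring
  simp only [h2, Complex.cpow_natCast, Complex.I_sq, div_one, mul_one, neg_mul, one_mul] at h
  rw [charFun_apply, integral_standardGaussian]
  have hpi : (π : ℂ) ^ finrank ℂ E ≠ 0 := by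
    have := Real.pi_ne_zero
    exact pow_ne_zero _ (by exact_mod_cast this)
  rw [← mul_right_inj' hpi, ← h, ← integral_const_mul]
  refine integral_congr_ae (Filter.Eventually.of_forall fun x => ?_)
  simp only [Complex.real_smul, Complex.exp_add]
  push_cast
  rw [real_inner_comm, mul_comm Complex.I]
  field_simp

variable {F : Type*} [NormedAddCommGroup F] [InnerProductSpace ℂ F] [FiniteDimensional ℂ F]
  [MeasurableSpace F] [BorelSpace F]

/-- The image of the standard Gaussian law under a linear map whose adjoint is isometric. -/
lemma map_standardGaussian (T : E →L[ℂ] F) (S : F →ₗᵢ[ℂ] E)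
    (hTS : ∀ x y, inner ℂ (T x) y = inner ℂ x (S y)) :
    (standardGaussian E).map T = standardGaussian F := by
  have : IsProbabilityMeasure ((standardGaussian E).map T) :=
    Measure.isProbabilityMeasure_map T.continuous.aemeasurable
  refine Measure.ext_of_charFun (funext fun t => ?_)
  rw [charFun_standardGaussian, charFun_apply,
    integral_map T.continuous.aemeasurable (by fun_prop), ← S.norm_map t,
    ← charFun_standardGaussian (S t), charFun_apply]
  simp only [real_inner_eq_re_inner ℂ, hTS]

lemma measurePreserving_linearIsometryEquiv (T : E ≃ₗᵢ[ℂ] F) :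
    MeasurePreserving T (standardGaussian E) (standardGaussian F) :=
  ⟨T.continuous.measurable, map_standardGaussian (T : E →L[ℂ] F) T.symm.toLinearIsometry
    fun x y => by
      have := T.inner_map_map x (T.symm y)
      simpa using this⟩

lemma standardGaussian_absolutelyContinuous : standardGaussian E ≪ volume :=
  withDensity_absolutelyContinuous _ _

/-- The orthogonal complement of a nonzero vector is a proper subspace, hence Lebesgue-null. -/
lemma ae_inner_ne_zero {w : E} (hw : w ≠ 0) : ∀ᵐ h ∂standardGaussian E, inner ℂ w h ≠ 0 := by
  refine standardGaussian_absolutelyContinuous.ae_le (ae_iff.2 ?_)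
  have := Measure.addHaar_submodule (volume : Measure E)
    ((LinearMap.ker (innerSL ℂ w : E →ₗ[ℂ] ℂ)).restrictScalars ℝ) (fun h => by
      have : w ∈ (LinearMap.ker (innerSL ℂ w : E →ₗ[ℂ] ℂ)).restrictScalars ℝ := by
        rw [h]; trivial
      exact hw (by simpa using this))
  convert this using 2
  ext x
  simp

/-- The squared norm of a standard Gaussian vector is Gamma distributed. -/
lemma integral_normSq_standardGaussian [Nontrivial E] (g : ℝ → ℝ) :
    ∫ x, g (‖x‖ ^ 2) ∂standardGaussian E = (Real.Gamma (finrank ℂ E))⁻¹ *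
      ∫ t in Set.Ioi (0 : ℝ), t ^ ((finrank ℂ E : ℝ) - 1) * Real.exp (-t) * g t := by
  have hn : 0 < finrank ℂ E := Module.finrank_pos
  -- Polar coordinates and the substitution `t = y²` give the formula up to a factor independent of
  -- `g`. Testing with `g = 1` then identifies the factor, so the volume of the unit ball is never
  -- computed.
  obtain ⟨K, hK⟩ : ∃ K : ℝ, ∀ g : ℝ → ℝ, ∫ x, g (‖x‖ ^ 2) ∂standardGaussian E = K *
      ∫ t in Set.Ioi (0 : ℝ), t ^ ((finrank ℂ E : ℝ) - 1) * Real.exp (-t) * g t := by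
    refine ⟨(finrank ℝ E) * (volume.real (Metric.ball (0 : E) 1)) * (π ^ finrank ℂ E)⁻¹ / 2,
      fun g => ?_⟩
    rw [integral_standardGaussian, integral_fun_norm_addHaar volume
      (fun y => ((π ^ finrank ℂ E)⁻¹ * Real.exp (-y ^ 2)) • g (y ^ 2)),
      ← integral_comp_rpow_Ioi_of_pos (p := 2)
        (g := fun t => t ^ ((finrank ℂ E : ℝ) - 1) * Real.exp (-t) * g t) two_pos]
    simp only [nsmul_eq_mul, smul_eq_mul]
    rw [div_mul_eq_mul_div, mul_assoc, mul_assoc, mul_div_assoc, mul_div_assoc]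
    congr 2
    rw [← integral_const_mul, ← integral_div]
    refine setIntegral_congr_fun measurableSet_Ioi fun y (hy : 0 < y) => ?_
    simp only [Real.rpow_two]
    have h1 : (y ^ 2) ^ ((finrank ℂ E : ℝ) - 1) * y = y ^ (finrank ℝ E - 1) := by
      have : (finrank ℂ E : ℝ) - 1 = ((finrank ℂ E - 1 : ℕ) : ℝ) := by
        rw [Nat.cast_sub hn]; simp
      rw [this, Real.rpow_natCast, ← pow_mul, ← pow_succ, finrank_real_of_complex]
      congr 1
      omega
    rw [← h1]
    have h2 : y ^ ((2 : ℝ) - 1) = y := by norm_num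
    rw [h2]
    ring
  have h1 := hK fun _ => 1
  simp only [integral_const, probReal_univ, smul_eq_mul, mul_one] at h1
  have h2 : ∫ t in Set.Ioi (0 : ℝ), t ^ ((finrank ℂ E : ℝ) - 1) * Real.exp (-t)
      = Real.Gamma (finrank ℂ E) := by
    rw [Real.Gamma_eq_integral (by exact_mod_cast hn)]
    simp only [mul_comm]
  rw [h2] at h1
  rw [hK g, eq_inv_of_mul_eq_one_left h1.symm]

/-- Directional second moments of a rotation invariant function of a standard Gaussian vector. -/
lemma integral_mul_normSq_inner_standardGaussian {Φ : ℝ → ℝ} (hΦ : Measurable Φ)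
    (hInt : Integrable (fun x : E => Φ (‖x‖ ^ 2) * ‖x‖ ^ 2) (standardGaussian E)) (w : E) :
    ∫ x, Φ (‖x‖ ^ 2) * ‖inner ℂ w x‖ ^ 2 ∂standardGaussian E
      = ‖w‖ ^ 2 / finrank ℂ E * ∫ x, Φ (‖x‖ ^ 2) * ‖x‖ ^ 2 ∂standardGaussian E := by
  rcases eq_or_ne w 0 with rfl | hw
  · simp
  have hw' : (‖w‖ : ℂ) ≠ 0 := by simpa using hw
  set v : E := ((‖w‖ : ℂ)⁻¹) • w with hv
  have hv1 : ‖v‖ = 1 := by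
    rw [hv, norm_smul]; simp [hw]
  have hwv : w = (‖w‖ : ℂ) • v := by rw [hv, smul_smul, mul_inv_cancel₀ hw', one_smul]
  have : Nontrivial E := ⟨⟨w, 0, hw⟩⟩
  have hn : 0 < finrank ℂ E := Module.finrank_pos
  have hort : Orthonormal ℂ (Set.domRestrict {(⟨0, hn⟩ : Fin (finrank ℂ E))} fun _ => v) := by
    rw [orthonormal_iff_ite]
    rintro ⟨i, rfl⟩ ⟨j, rfl⟩
    simp [Set.domRestrict, hv1]
  obtain ⟨b, hb⟩ := hort.exists_orthonormalBasis_extension_of_card_eq (by simp)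
  have hb0 : b ⟨0, hn⟩ = v := hb _ rfl
  -- The unitary map exchanging `b i` and `v` preserves the law and the norm, so every basis
  -- direction contributes equally. By Parseval each contribution is a `finrank`-th of the total.
  have hsame : ∀ i, ∫ x, Φ (‖x‖ ^ 2) * ‖inner ℂ (b i) x‖ ^ 2 ∂standardGaussian E
      = ∫ x, Φ (‖x‖ ^ 2) * ‖inner ℂ v x‖ ^ 2 ∂standardGaussian E := by
    intro i
    set T : E ≃ₗᵢ[ℂ] E := b.equiv b (Equiv.swap i ⟨0, hn⟩) with hT
    have hTv : T (b i) = v := by rw [hT, OrthonormalBasis.equiv_apply_basis]; simp [hb0]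
    rw [← (measurePreserving_linearIsometryEquiv T).integral_comp
      T.toHomeomorph.measurableEmbedding (fun x => Φ (‖x‖ ^ 2) * ‖inner ℂ v x‖ ^ 2)]
    simp only [LinearIsometryEquiv.norm_map]
    simp only [← hTv, LinearIsometryEquiv.inner_map_map]
  have hI : ∀ i, Integrable (fun x => Φ (‖x‖ ^ 2) * ‖inner ℂ (b i) x‖ ^ 2)
      (standardGaussian E) := by
    intro i
    refine hInt.mono (by fun_prop) (Filter.Eventually.of_forall fun x => ?_)
    rw [norm_mul, norm_mul]
    refine mul_le_mul_of_nonneg_left ?_ (norm_nonneg _)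
    have := norm_inner_le_norm (𝕜 := ℂ) (b i) x
    rw [b.orthonormal.1 i, one_mul] at this
    simpa using pow_le_pow_left₀ (norm_nonneg _) this 2
  have hsum : ∫ x, Φ (‖x‖ ^ 2) * ‖x‖ ^ 2 ∂standardGaussian E
      = ∑ i, ∫ x, Φ (‖x‖ ^ 2) * ‖inner ℂ (b i) x‖ ^ 2 ∂standardGaussian E := by
    rw [← integral_finsetSum _ fun i _ => hI i]
    refine integral_congr_ae (Filter.Eventually.of_forall fun x => ?_)
    simp only
    rw [← Finset.mul_sum, b.sum_sq_norm_inner_right]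
  have hw2 : ∀ x, ‖inner ℂ w x‖ ^ 2 = ‖w‖ ^ 2 * ‖inner ℂ v x‖ ^ 2 := by
    intro x
    conv_lhs => rw [hwv, inner_smul_left]
    simp [mul_pow]
  simp only [hsum, hsame, hw2, Finset.sum_const, Finset.card_univ, Fintype.card_fin, nsmul_eq_mul]
  simp only [mul_left_comm _ (‖w‖ ^ 2), integral_const_mul]
  have : (finrank ℂ E : ℝ) ≠ 0 := by positivity
  field_simp

end Gaussian

/-! ### Projection onto the orthogonal complement of the quantized direction. -/

section Projection

variable {L : ℕ}

/-- The component of `h` orthogonal to a unit vector `u`. -/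
def perp (u h : CVec L) : CVec L := h - (inner ℂ u h : ℂ) • u

lemma measurable_perp : Measurable fun q : CVec L × CVec L => perp q.1 q.2 := by
  unfold perp; fun_prop

lemma inner_perp {u : CVec L} (h : CVec L) (hu : ‖u‖ = 1) : inner ℂ u (perp u h) = 0 := by
  rw [perp, inner_sub_right, inner_smul_right, inner_self_eq_norm_sq_to_K, hu]; simp

lemma inner_perp_right {u : CVec L} (s h : CVec L) (hu : ‖u‖ = 1) :
    inner ℂ s (perp u h) = inner ℂ (perp u s) (perp u h) := by
  conv_rhs => rw [perp, inner_sub_left, inner_smul_left, inner_perp h hu]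
  simp

lemma norm_perp_sq {u : CVec L} (h : CVec L) (hu : ‖u‖ = 1) :
    ‖perp u h‖ ^ 2 = ‖h‖ ^ 2 - ‖inner ℂ u h‖ ^ 2 := by
  have h1 : h = perp u h + (inner ℂ u h : ℂ) • u := by simp [perp]
  have h2 : inner ℂ (perp u h) ((inner ℂ u h : ℂ) • u) = 0 := by
    rw [inner_smul_right, ← inner_conj_symm (perp u h) u, inner_perp h hu]; simp
  have h3 := norm_add_sq (𝕜 := ℂ) (perp u h) ((inner ℂ u h : ℂ) • u)
  rw [← h1, h2, norm_smul, hu] at h3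
  simp at h3
  linarith

lemma coe_orthogonalProjection_eq_perp {u : CVec L} (hu : ‖u‖ = 1) (h : CVec L) :
    ((ℂ ∙ u)ᗮ.orthogonalProjectionOnto h : CVec L) = perp u h := by
  rw [← Submodule.starProjection_apply, Submodule.starProjection_orthogonal_val,
    Submodule.starProjection_unit_singleton ℂ hu]
  rfl

/-- The component of a standard Gaussian vector orthogonal to `u` is a standard Gaussian vector
of the orthogonal complement of `u`. -/
lemma map_orthogonalProjection_standardGaussian (K : Submodule ℂ (CVec L)) :
    (standardGaussian (CVec L)).map K.orthogonalProjectionOnto = standardGaussian K := by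
  refine map_standardGaussian (E := CVec L) (F := K) K.orthogonalProjectionOnto K.subtypeₗᵢ
    fun x y => ?_
  exact Submodule.inner_orthogonalProjectionOnto_eq_of_mem_right y x

/-- Transfers averages to a space of dimension one less, where the rotation invariance of the
standard Gaussian can be used afresh. -/
lemma integral_perp {u : CVec L} (hu : ‖u‖ = 1) {G : CVec L → ℝ} (hG : Measurable G) :
    ∫ h, G (perp u h) ∂standardGaussian (CVec L)
      = ∫ y : (ℂ ∙ u)ᗮ, G y ∂standardGaussian (ℂ ∙ u)ᗮ := by
  rw [← map_orthogonalProjection_standardGaussian, integral_map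
    (by fun_prop) (f := fun y : (ℂ ∙ u)ᗮ => G y)
    (hG.comp measurable_subtype_coe).aestronglyMeasurable]
  simp only [coe_orthogonalProjection_eq_perp hu]

lemma finrank_orthogonal_span {u : CVec L} (hu : ‖u‖ = 1) : finrank ℂ (ℂ ∙ u)ᗮ = L - 1 := by
  have h0 : u ≠ 0 := by rintro rfl; simp at hu
  have := Submodule.finrank_add_finrank_orthogonal (ℂ ∙ u)
  rw [finrank_span_singleton h0, finrank_euclideanSpace_fin] at this
  omega

end Projection

/-! ### Identification of the channel laws with standard Gaussians. -/

section Laws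

instance isProbabilityMeasure_complexGaussian (v : ℝ) :
    IsProbabilityMeasure (complexGaussian v) :=
  Measure.isProbabilityMeasure_map (Complex.measurableEquivRealProd.symm.measurable.aemeasurable)

lemma charFun_complexGaussian {v : ℝ} (hv : 0 ≤ v) (s : ℂ) :
    charFun (complexGaussian v) s = Complex.exp (-v * ‖s‖ ^ 2 / 4) := by
  rw [charFun_apply, complexGaussian, integral_map_equiv]
  have h : ∀ x : ℝ × ℝ, Complex.exp (((inner ℝ (Complex.measurableEquivRealProd.symm x) s : ℝ) : ℂ)
      * Complex.I) = Complex.exp ((s.re * x.1 : ℝ) * Complex.I) *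
        Complex.exp ((s.im * x.2 : ℝ) * Complex.I) := by
    intro x
    rw [← Complex.exp_add]
    congr 1
    simp [Complex.measurableEquivRealProd]
    ring
  simp only [h]
  rw [integral_prod_mul (fun x : ℝ => Complex.exp ((s.re * x : ℝ) * Complex.I))
    (fun y : ℝ => Complex.exp ((s.im * y : ℝ) * Complex.I))]
  have h2 := fun t : ℝ => charFun_gaussianReal (μ := 0) (v := (v / 2).toNNReal) t
  simp only [charFun_apply_real] at h2
  simp only [Complex.ofReal_mul, h2]
  rw [← Complex.exp_add]
  congr 1
  have hv2 : (((v / 2).toNNReal : ℝ) : ℂ) = v / 2 := by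
    rw [Real.coe_toNNReal _ (by positivity)]; push_cast; rfl
  have hs : ((‖s‖ : ℝ) : ℂ) ^ 2 = (s.re : ℂ) ^ 2 + (s.im : ℂ) ^ 2 := by
    rw [← Complex.ofReal_pow, Complex.sq_norm, Complex.normSq_apply]; push_cast; ring
  rw [hv2, hs]
  push_cast
  ring

lemma complexGaussian_one : complexGaussian 1 = standardGaussian ℂ := by
  refine Measure.ext_of_charFun (funext fun t => ?_)
  rw [charFun_complexGaussian zero_le_one, charFun_standardGaussian]
  simp

variable {Ω : Type*} [MeasurableSpace Ω] {μ : Measure Ω} {L : ℕ} {v : ℝ} {h : Ω → CVec L}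

lemma IsIIDComplexGaussian.aemeasurable (hh : IsIIDComplexGaussian μ v h) : AEMeasurable h μ := by
  have : AEMeasurable (fun ω i => h ω i) μ := aemeasurable_pi_lambda _ fun i => (hh.2 i).aemeasurable
  exact (MeasurableEquiv.toLp 2 (Fin L → ℂ)).measurable.comp_aemeasurable this

/-- Independence makes the joint law a product measure, so its characteristic function factors over
the coordinates and can be compared with that of the standard Gaussian. -/
lemma IsIIDComplexGaussian.map_smul [IsProbabilityMeasure μ] (hh : IsIIDComplexGaussian μ v h)
    (hv : 0 < v) : μ.map (fun ω => (√v)⁻¹ • h ω) = standardGaussian (CVec L) := by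
  have hm := hh.aemeasurable
  have : IsProbabilityMeasure (μ.map fun ω => (√v)⁻¹ • h ω) :=
    Measure.isProbabilityMeasure_map (by fun_prop)
  have hpi : μ.map (fun ω i => h ω i) = Measure.pi fun _ : Fin L => complexGaussian v := by
    rw [hh.1.map_fun_eq_pi_map fun i => (hh.2 i).aemeasurable]
    simp only [(hh.2 _).map_eq]
  refine Measure.ext_of_charFun (funext fun t => ?_)
  rw [charFun_standardGaussian, charFun_apply, integral_map (by fun_prop) (by fun_prop)]
  have h1 : ∀ ω, Complex.exp (((inner ℝ ((√v)⁻¹ • h ω) t : ℝ) : ℂ) * Complex.I)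
      = (fun z : Fin L → ℂ => ∏ i, Complex.exp (((inner ℝ (z i) ((√v)⁻¹ • t i) : ℝ) : ℂ)
        * Complex.I)) (fun i => h ω i) := by
    intro ω
    simp only
    rw [← Complex.exp_sum, ← Finset.sum_mul]
    congr 2
    norm_cast
    rw [real_inner_eq_re_inner ℂ, PiLp.inner_apply, map_sum]
    refine Finset.sum_congr rfl fun i _ => ?_
    simp
    ring
  simp only [h1]
  rw [← integral_map (φ := fun ω i => h ω i)
    (f := fun z : Fin L → ℂ => ∏ i, Complex.exp (((inner ℝ (z i) ((√v)⁻¹ • t i) : ℝ) : ℂ)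
        * Complex.I)) (aemeasurable_pi_lambda _ fun i => (hh.2 i).aemeasurable)
    (by refine Continuous.aestronglyMeasurable ?_; fun_prop),
    hpi, integral_fintype_prod_eq_prod (fun i (z : ℂ) =>
      Complex.exp (((inner ℝ z ((√v)⁻¹ • t i) : ℝ) : ℂ) * Complex.I))]
  simp only [← charFun_apply, charFun_complexGaussian hv.le]
  rw [← Complex.exp_sum, EuclideanSpace.norm_eq, ← Complex.ofReal_pow,
    Real.sq_sqrt (by positivity)]
  congr 1
  push_cast
  rw [← Finset.sum_neg_distrib, Finset.sum_div]
  refine Finset.sum_congr rfl fun i _ => ?_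
  rw [norm_smul]
  have : ‖(√v)⁻¹‖ ^ 2 = v⁻¹ := by
    rw [norm_inv, Real.norm_eq_abs, inv_pow, sq_abs, Real.sq_sqrt hv.le]
  have h3 : (v : ℂ) ≠ 0 := by exact_mod_cast hv.ne'
  rw [← Complex.ofReal_pow, mul_pow, this]
  push_cast
  field_simp

end Laws

/-! ### Moments of the gains. -/

section Moments

lemma nontrivial_CVec {L : ℕ} (hL : 1 ≤ L) : Nontrivial (CVec L) := by
  have : Nonempty (Fin L) := ⟨⟨0, hL⟩⟩
  infer_instance

lemma integral_norm_pow_standardGaussian {L : ℕ} (hL : 1 ≤ L) (k : ℕ) :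
    Integrable (fun x : CVec L => (‖x‖ ^ 2) ^ k) (standardGaussian (CVec L)) ∧
    ∫ x, (‖x‖ ^ 2) ^ k ∂standardGaussian (CVec L) = Real.Gamma (L + k) / Real.Gamma L := by
  have := nontrivial_CVec hL
  have hL0 : (0 : ℝ) < L := by exact_mod_cast hL
  have h := integral_normSq_standardGaussian (E := CVec L) fun t => t ^ k
  rw [finrank_euclideanSpace_fin] at h
  have h2 : ∫ t in Set.Ioi (0 : ℝ), t ^ ((L : ℝ) - 1) * Real.exp (-t) * t ^ k
      = Real.Gamma (L + k) := by
    rw [Real.Gamma_eq_integral (by positivity)]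
    refine setIntegral_congr_fun measurableSet_Ioi fun t (ht : 0 < t) => ?_
    rw [add_sub_right_comm, Real.rpow_add ht, Real.rpow_natCast]
    ring
  rw [h2] at h
  have h3 : ∫ x, (‖x‖ ^ 2) ^ k ∂standardGaussian (CVec L) = Real.Gamma (L + k) / Real.Gamma L := by
    rw [h]; ring
  refine ⟨?_, h3⟩
  -- A non-integrable function has Bochner integral 0, whereas the value just computed is positive.
  by_contra hI
  rw [integral_undef hI] at h3
  have h4 : 0 < Real.Gamma (L + k) / Real.Gamma L :=
    div_pos (Real.Gamma_pos_of_pos (by positivity)) (Real.Gamma_pos_of_pos hL0)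
  exact h4.ne h3

/-- In complex dimension one the Gamma law of the squared norm is exponential of rate 1. -/
lemma standardGaussian_real_annulus {s t : ℝ} (hs : 0 ≤ s) (hst : s ≤ t) :
    (standardGaussian ℂ).real {z | s ≤ ‖z‖ ^ 2 ∧ ‖z‖ ^ 2 ≤ t}
      = Real.exp (-s) - Real.exp (-t) := by
  have hm : MeasurableSet {z : ℂ | s ≤ ‖z‖ ^ 2 ∧ ‖z‖ ^ 2 ≤ t} :=
    (isClosed_Icc (a := s) (b := t)).measurableSet.preimage
      (f := fun z : ℂ => ‖z‖ ^ 2) (by fun_prop)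
  have h := integral_normSq_standardGaussian (E := ℂ) ((Set.Icc s t).indicator fun _ => 1)
  have h2 : (fun z : ℂ => (Set.Icc s t).indicator (fun _ => (1 : ℝ)) (‖z‖ ^ 2))
      = {z : ℂ | s ≤ ‖z‖ ^ 2 ∧ ‖z‖ ^ 2 ≤ t}.indicator 1 := by
    ext z; rfl
  rw [h2, integral_indicator_one hm] at h
  rw [h, Module.finrank_self]
  have h3 : ∀ r : ℝ, r ^ ((1 : ℕ) - 1 : ℝ) * Real.exp (-r) * (Set.Icc s t).indicator (fun _ => 1) r
      = (Set.Icc s t).indicator (fun r => Real.exp (-r)) r := by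
    intro r
    simp [Set.indicator_apply]
  simp only [h3]
  rw [setIntegral_indicator measurableSet_Icc]
  have h4 : ∫ r in Set.Ioi 0 ∩ Set.Icc s t, Real.exp (-r) = ∫ r in Set.Ioc s t, Real.exp (-r) := by
    refine setIntegral_congr_set ?_
    have e : (Set.Icc s t : Set ℝ) =ᵐ[volume] Set.Ioc s t := Ioc_ae_eq_Icc.symm
    have h6 := (Filter.EventuallyEq.refl (ae volume) (Set.Ioi (0 : ℝ))).inter e
    have h7 : Set.Ioc s t ⊆ Set.Ioi 0 := fun r hr => hs.trans_lt hr.1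
    rwa [Set.inter_eq_right.2 h7] at h6
  rw [h4, ← intervalIntegral.integral_of_le hst]
  have h5 : ∫ r in s..t, Real.exp (-r) = Real.exp (-s) - Real.exp (-t) := by
    rw [intervalIntegral.integral_comp_neg fun r => Real.exp r, integral_exp]
  rw [h5]
  simp

end Moments

/-! ### Truncated moments of the orthogonal component. -/

section PerpMoments

variable {L : ℕ} {u : CVec L}

lemma nontrivial_orthogonal (hL : 2 ≤ L) (hu : ‖u‖ = 1) : Nontrivial (ℂ ∙ u)ᗮ := by
  apply Module.nontrivial_of_finrank_pos (R := ℂ)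
  rw [finrank_orthogonal_span hu]
  omega

/-- The squared norm of the component orthogonal to `u` has the `Γ(L - 1)` law. -/
lemma integral_norm_perp_sq (hL : 2 ≤ L) (hu : ‖u‖ = 1) {g : ℝ → ℝ} (hg : Measurable g) :
    ∫ h, g (‖perp u h‖ ^ 2) ∂standardGaussian (CVec L) = (Real.Gamma ((L : ℝ) - 1))⁻¹ *
      ∫ t in Set.Ioi (0 : ℝ), t ^ ((L : ℝ) - 2) * Real.exp (-t) * g t := by
  have := nontrivial_orthogonal hL hu
  rw [integral_perp hu (G := fun x => g (‖x‖ ^ 2)) (by fun_prop)]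
  have h := integral_normSq_standardGaussian (E := (ℂ ∙ u)ᗮ) g
  rw [finrank_orthogonal_span hu, Nat.cast_sub (by omega), Nat.cast_one,
    show (L : ℝ) - 1 - 1 = L - 2 by ring] at h
  exact h

lemma integral_Ioi_mul_indicator {a : ℝ} (ha : 0 < a) (s : ℝ) (f : ℝ → ℝ) (k : ℝ → ℝ)
    (hk : ∀ t, a < t → f t * k t = t ^ (s - 1) * Real.exp (-t)) :
    ∫ t in Set.Ioi (0 : ℝ), f t * (Set.Ioi a).indicator k t = upperGamma s a := by
  have h1 : ∀ t, f t * (Set.Ioi a).indicator k t = (Set.Ioi a).indicator (fun t => f t * k t) t := by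
    intro t; simp [Set.indicator_apply]
  simp only [h1]
  rw [setIntegral_indicator measurableSet_Ioi,
    Set.inter_eq_right.2 (Set.Ioi_subset_Ioi ha.le), upperGamma]
  exact setIntegral_congr_fun measurableSet_Ioi fun t ht => hk t ht

lemma real_norm_perp_sq_gt (hL : 2 ≤ L) (hu : ‖u‖ = 1) {a : ℝ} (ha : 0 < a) :
    ∫ h, (Set.Ioi a).indicator (fun _ => (1 : ℝ)) (‖perp u h‖ ^ 2) ∂standardGaussian (CVec L)
      = upperGamma ((L : ℝ) - 1) a / Real.Gamma ((L : ℝ) - 1) := by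
  rw [integral_norm_perp_sq hL hu (by fun_prop (disch := measurability)),
    integral_Ioi_mul_indicator ha ((L : ℝ) - 1)]
  · ring
  · intro t _
    rw [show (L : ℝ) - 1 - 1 = L - 2 by ring, mul_one]

/-- The factor `t⁻¹` lowers the Gamma shape by one. Truncation at `a > 0` keeps the integral finite
even for `L = 2`, where the shape becomes 0. -/
lemma integral_inv_norm_perp_sq (hL : 2 ≤ L) (hu : ‖u‖ = 1) {a : ℝ} (ha : 0 < a) :
    ∫ h, (Set.Ioi a).indicator (fun t => t⁻¹) (‖perp u h‖ ^ 2) ∂standardGaussian (CVec L)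
      = upperGamma ((L : ℝ) - 2) a / Real.Gamma ((L : ℝ) - 1) := by
  rw [integral_norm_perp_sq hL hu (measurable_inv.indicator measurableSet_Ioi),
    integral_Ioi_mul_indicator ha ((L : ℝ) - 2)]
  · ring
  · intro t ht
    rw [Real.rpow_sub_one (ha.trans ht).ne']
    ring

/-- Only `perp u s` pairs with the complement of `u`. Directional averaging there replaces the
squared inner product by a multiple of `‖perp u h‖²`, which leaves one inverse power in the
truncated weight. -/
lemma integral_inner_perp (hL : 2 ≤ L) (hu : ‖u‖ = 1) {a : ℝ} (ha : 0 < a) (s : CVec L) :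
    ∫ h, (Set.Ioi a).indicator (fun t => (t ^ 2)⁻¹) (‖perp u h‖ ^ 2) * ‖inner ℂ s (perp u h)‖ ^ 2
        ∂standardGaussian (CVec L)
      = ‖perp u s‖ ^ 2 / ((L : ℝ) - 1) *
        (upperGamma ((L : ℝ) - 2) a / Real.Gamma ((L : ℝ) - 1)) := by
  have hΦ : Measurable ((Set.Ioi a).indicator fun t : ℝ => (t ^ 2)⁻¹) :=
    Measurable.indicator (by fun_prop) measurableSet_Ioi
  have key : ∀ t, (Set.Ioi a).indicator (fun t : ℝ => (t ^ 2)⁻¹) t * t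
      = (Set.Ioi a).indicator (fun t => t⁻¹) t := by
    intro t
    by_cases ht : t ∈ Set.Ioi a
    · have : t ≠ 0 := (ha.trans (Set.mem_Ioi.1 ht)).ne'
      rw [Set.indicator_of_mem ht, Set.indicator_of_mem ht]
      field_simp
    · rw [Set.indicator_of_notMem ht, Set.indicator_of_notMem ht, zero_mul]
  have hK : perp u s ∈ (ℂ ∙ u)ᗮ := by
    rw [Submodule.mem_orthogonal_singleton_iff_inner_right]; exact inner_perp s hu
  have hInt : Integrable (fun x : (ℂ ∙ u)ᗮ => (Set.Ioi a).indicator (fun t : ℝ => (t ^ 2)⁻¹)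
      (‖x‖ ^ 2) * ‖x‖ ^ 2) (standardGaussian (ℂ ∙ u)ᗮ) := by
    simp only [key]
    refine Integrable.of_bound (C := a⁻¹)
      ((measurable_inv.indicator measurableSet_Ioi).comp (by fun_prop)).aestronglyMeasurable
      (Filter.Eventually.of_forall fun x => ?_)
    by_cases ht : ‖x‖ ^ 2 ∈ Set.Ioi a
    · rw [Set.indicator_of_mem ht, norm_inv, Real.norm_of_nonneg (by positivity)]
      exact inv_anti₀ ha (Set.mem_Ioi.1 ht).le
    · rw [Set.indicator_of_notMem ht, norm_zero]; positivity
  have h1 := integral_mul_normSq_inner_standardGaussian hΦ hInt ⟨perp u s, hK⟩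
  simp only [key] at h1
  rw [← integral_inv_norm_perp_sq hL hu ha, integral_perp hu
    (G := fun x => (Set.Ioi a).indicator (fun t => t⁻¹) (‖x‖ ^ 2))
    ((measurable_inv.indicator measurableSet_Ioi).comp (by fun_prop))]
  rw [finrank_orthogonal_span hu, Nat.cast_sub (by omega), Nat.cast_one] at h1
  simp only [inner_perp_right s _ hu]
  rw [integral_perp hu (G := fun x => (Set.Ioi a).indicator (fun t => (t ^ 2)⁻¹) (‖x‖ ^ 2) *
    ‖inner ℂ (perp u s) x‖ ^ 2) ((hΦ.comp (by fun_prop)).mul (by fun_prop))]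
  exact h1

lemma ae_inner_perp_ne_zero (hu : ‖u‖ = 1) {s : CVec L} (hs : perp u s ≠ 0) :
    ∀ᵐ h ∂standardGaussian (CVec L), inner ℂ s (perp u h) ≠ 0 := by
  filter_upwards [ae_inner_ne_zero hs] with h hh
  rwa [inner_perp_right s h hu, perp.eq_def u h, inner_sub_right, inner_smul_right,
    ← inner_conj_symm (perp u s) u, inner_perp s hu, map_zero, mul_zero, sub_zero]

end PerpMoments

/-! ### The optimal beam and the outage event. -/

section Beamforming

variable {L : ℕ} {u : CVec L}

lemma perp_smul (u h : CVec L) (c : ℂ) : perp u (c • h) = c • perp u h := by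
  rw [perp, perp, inner_smul_right, smul_sub, smul_smul]

lemma norm_shape {h : CVec L} (hh : h ≠ 0) : ‖shape h‖ = 1 := by
  rw [shape, norm_smul]; simp [hh]

lemma norm_smul_shape (h : CVec L) : ((‖h‖ : ℝ) : ℂ) • shape h = h := by
  rcases eq_or_ne h 0 with rfl | hh
  · simp
  · have : ((‖h‖ : ℝ) : ℂ) ≠ 0 := by simpa using hh
    rw [shape, smul_smul, Complex.ofReal_inv, mul_inv_cancel₀ this, one_smul]

lemma measurable_shape : Measurable (shape : CVec L → CVec L) := by
  unfold shape; fun_prop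

lemma norm_sq_mul_normSq_inner_shape (v h : CVec L) :
    ‖h‖ ^ 2 * ‖inner ℂ v (shape h)‖ ^ 2 = ‖inner ℂ v h‖ ^ 2 := by
  conv_rhs => rw [← norm_smul_shape h, inner_smul_right]
  simp [mul_pow]

lemma shape_smul {c : ℝ} (hc : 0 < c) (h : CVec L) : shape ((c : ℂ) • h) = shape h := by
  have : (c : ℂ) ≠ 0 := by exact_mod_cast hc.ne'
  rw [shape, shape, smul_smul, norm_smul, Complex.norm_real, Real.norm_of_nonneg hc.le]
  congr 1
  push_cast
  field_simp

lemma perpDir_shape (u h : CVec L) : perpDir u (shape h) = shape (perp u h) := by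
  rcases eq_or_ne h 0 with rfl | hh
  · simp [perpDir, shape, perp]
  · change shape (perp u (shape h)) = _
    rw [shape.eq_def h, perp_smul, shape_smul (by positivity)]

lemma norm_perp_sq_shape (u h : CVec L) :
    ‖h‖ ^ 2 * ‖perp u (shape h)‖ ^ 2 = ‖perp u h‖ ^ 2 := by
  conv_rhs => rw [← norm_smul_shape h, perp_smul, norm_smul]
  simp [mul_pow]

lemma cdiError_eq {s : CVec L} (hu : ‖u‖ = 1) (hs : ‖s‖ = 1) :
    cdiError u s = ‖perp u s‖ ^ 2 := by
  rw [cdiError, norm_perp_sq s hu, hs, one_pow]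

/-- The constraint lets `f` see only `perp u s`, so Cauchy–Schwarz bounds the gain; the vector of
norm `√P` along `perp u s` is feasible and attains the bound. -/
lemma IsOCB.normSq_inner {s f : CVec L} {P : ℝ} (hu : ‖u‖ = 1) (hP : 0 ≤ P)
    (h : IsOCB u s P f) : ‖inner ℂ f s‖ ^ 2 = P * ‖perp u s‖ ^ 2 := by
  obtain ⟨⟨hf0, hfP⟩, hmax⟩ := h
  apply le_antisymm
  · have h1 : inner ℂ f s = inner ℂ f (perp u s) := by
      rw [perp, inner_sub_right, inner_smul_right, hf0]; simp
    rw [h1]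
    calc ‖inner ℂ f (perp u s)‖ ^ 2 ≤ (‖f‖ * ‖perp u s‖) ^ 2 :=
          pow_le_pow_left₀ (norm_nonneg _) (norm_inner_le_norm _ _) 2
      _ = ‖f‖ ^ 2 * ‖perp u s‖ ^ 2 := mul_pow _ _ _
      _ ≤ _ := mul_le_mul_of_nonneg_right hfP (by positivity)
  · rcases eq_or_ne (perp u s) 0 with h0 | h0
    · rw [h0]; simp
    have hv := hmax (show ((√P : ℝ) : ℂ) • shape (perp u s) ∈ _ from ⟨by
      rw [shape, inner_smul_left, inner_smul_left, ← inner_conj_symm, inner_perp s hu]; simp, by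
      rw [norm_smul, norm_shape h0, Complex.norm_real, mul_one, Real.norm_eq_abs, sq_abs,
        Real.sq_sqrt hP]⟩)
    refine le_trans (le_of_eq ?_) hv
    have h2 : ‖inner ℂ (shape (perp u s)) s‖ = ‖perp u s‖ := by
      have h3 : inner ℂ (perp u s) s = ((‖perp u s‖ : ℝ) : ℂ) ^ 2 := by
        have h5 : s = perp u s + (inner ℂ u s : ℂ) • u := by simp [perp]
        rw [congrArg (inner ℂ (perp u s)) h5, inner_add_right, inner_smul_right,
          ← inner_conj_symm (perp u s) u, inner_perp s hu]
        simp [inner_self_eq_norm_sq_to_K]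
      rw [shape, inner_smul_left, h3]
      have : ‖perp u s‖ ≠ 0 := by simpa using h0
      simp
      field_simp
    simp only [inner_smul_left, norm_mul, h2]
    rw [mul_pow, RCLike.norm_conj, Complex.norm_real, Real.norm_eq_abs, sq_abs, Real.sq_sqrt hP]

/-- The ratio `δ / ‖h^⊥‖²`. -/
def leakRatio (s u h : CVec L) : ℝ := ‖inner ℂ s (perp u h)‖ ^ 2 / (‖perp u h‖ ^ 2) ^ 2

/-- A minimum is below the threshold iff one of its arguments is: the cap gives the first
alternative, the interference constraint the second. The hypothesis `hne` excludes `δ = 0`, where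
division by zero would set the power to 0. -/
lemma snrS_le_iff {p : Params} {hp : ℂ} {hx u hs f : CVec p.L} (hlam : 0 < p.lam)
    (hthetaP : 0 < p.thetaP) (hPp : 0 < p.Pp) (hPmax : 0 < p.Pmax)
    (hnoise : 0 < p.noise) (hu : ‖u‖ = 1)
    (hne : inner ℂ (shape hx) (perp u hs) ≠ 0)
    (hf : IsOCB u (shape hs) (powerBudget p hp hx u hs) f) :
    snrS p hs f ≤ p.thetaS ↔ ‖perp u hs‖ ^ 2 ≤ p.thetaS / p.gammaMax ∨
      (p.thetaP / p.gammaP ≤ ‖hp‖ ^ 2 ∧ ‖hp‖ ^ 2 ≤ p.thetaP / p.gammaP +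
        p.thetaP / p.gammaP * p.thetaS * p.lam * (‖hx‖ ^ 2 / p.lam) *
          leakRatio (shape hx) u hs) := by
  have hq : 0 < ‖perp u hs‖ ^ 2 := by
    have : perp u hs ≠ 0 := by intro h; rw [h] at hne; simp at hne
    positivity
  have hX : 0 < ‖hx‖ ^ 2 := by
    have : hx ≠ 0 := by rintro rfl; simp [shape] at hne
    positivity
  have hI : 0 < ‖inner ℂ (shape hx) (perp u hs)‖ ^ 2 := by positivity
  have hδ : ‖inner ℂ (shape hx) (perpDir u (shape hs))‖ ^ 2
      = ‖inner ℂ (shape hx) (perp u hs)‖ ^ 2 / ‖perp u hs‖ ^ 2 := by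
    rw [perpDir_shape, eq_div_iff hq.ne', mul_comm, norm_sq_mul_normSq_inner_shape]
  have hgP : 0 < p.gammaP := div_pos hPp hnoise
  have hgM : 0 < p.gammaMax := div_pos hPmax hnoise
  set P := powerBudget p hp hx u hs with hPdef
  have hP : 0 ≤ P := by
    rw [hPdef, powerBudget, ipcFeedforward]
    refine le_min ?_ hPmax.le
    split_ifs with h
    · positivity
    · exact hPmax.le
  have hsnr : snrS p hs f = P * ‖perp u hs‖ ^ 2 / p.noise := by
    rw [snrS, hf.normSq_inner hu hP, ← norm_perp_sq_shape u hs]; ring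
  have hmax : p.Pmax * ‖perp u hs‖ ^ 2 / p.noise ≤ p.thetaS ↔
      ‖perp u hs‖ ^ 2 ≤ p.thetaS / p.gammaMax := by
    rw [le_div_iff₀ hgM, Params.gammaMax]
    refine iff_of_eq (congrArg (· ≤ p.thetaS) ?_)
    ring
  have hmar : 0 ≤ margin p (‖hp‖ ^ 2) ↔ p.thetaP / p.gammaP ≤ ‖hp‖ ^ 2 := by
    rw [margin, mul_nonneg_iff_of_pos_left hnoise, sub_nonneg, le_div_iff₀ hthetaP,
      div_le_iff₀ hgP, one_mul, mul_comm]
  rw [hsnr, hPdef, powerBudget, ipcFeedforward, hδ]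
  by_cases hm : 0 ≤ margin p (‖hp‖ ^ 2)
  · rw [if_pos hm, min_mul_of_nonneg _ _ hq.le, ← min_div_div_right hnoise.le, min_le_iff, hmax,
      or_comm]
    refine or_congr Iff.rfl ?_
    rw [and_iff_right (hmar.1 hm), leakRatio, margin]
    set t := p.thetaP / p.gammaP with ht
    have ht0 : 0 < t := div_pos hthetaP hgP
    have e1 : p.gammaP * ‖hp‖ ^ 2 / p.thetaP = ‖hp‖ ^ 2 / t := by rw [ht]; field_simp
    rw [e1]
    have e2 : p.noise * (‖hp‖ ^ 2 / t - 1) / (p.lam * (‖hx‖ ^ 2 / p.lam) *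
        (‖inner ℂ (shape hx) (perp u hs)‖ ^ 2 / ‖perp u hs‖ ^ 2)) * ‖perp u hs‖ ^ 2 / p.noise
        = (‖hp‖ ^ 2 - t) / (t * p.lam * (‖hx‖ ^ 2 / p.lam) *
        (‖inner ℂ (shape hx) (perp u hs)‖ ^ 2 / (‖perp u hs‖ ^ 2) ^ 2)) := by
      field_simp
    rw [e2, div_le_iff₀ (by positivity), sub_le_iff_le_add']
    refine iff_of_eq (congrArg (‖hp‖ ^ 2 ≤ ·) ?_)
    ring
  · rw [if_neg hm, min_self, hmax, or_iff_left]
    exact fun h => hm (hmar.2 h.1)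

end Beamforming

/-! ### Consequences of the quantization error distribution. -/

section Quantizer

lemma two_rpow_pow {L : ℕ} (hL : 2 ≤ L) (B : ℕ) :
    (2 : ℝ) ^ B * ((2 : ℝ) ^ (-((B : ℝ) / ((L : ℝ) - 1)))) ^ (L - 1) = 1 := by
  have h1 : ((L - 1 : ℕ) : ℝ) = (L : ℝ) - 1 := by rw [Nat.cast_sub (by omega)]; simp
  have h2 : (L : ℝ) - 1 ≠ 0 := by
    have : (2 : ℝ) ≤ L := by exact_mod_cast hL
    linarith
  rw [← Real.rpow_mul_natCast (by norm_num), h1, neg_mul, div_mul_cancel₀ _ h2,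
    Real.rpow_neg (by norm_num), Real.rpow_natCast]
  exact mul_inv_cancel₀ (by positivity)

variable {Ω : Type*} [MeasurableSpace Ω] {μ : Measure Ω} [IsProbabilityMeasure μ]
  {L B : ℕ} {X : Ω → ℝ}

lemma ae_le_of_cdf (hL : 2 ≤ L) (hX : AEMeasurable X μ)
    (hcdf : ∀ τ, μ.real {ω | X ω ≤ τ} = cdiErrorCDF L B τ) :
    ∀ᵐ ω ∂μ, X ω ≤ (2 : ℝ) ^ (-((B : ℝ) / ((L : ℝ) - 1))) := by
  have h := hcdf ((2 : ℝ) ^ (-((B : ℝ) / ((L : ℝ) - 1))))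
  rw [cdiErrorCDF, if_neg (not_lt.2 (by positivity)), if_pos le_rfl, two_rpow_pow hL] at h
  rw [measureReal_def, ENNReal.toReal_eq_one_iff] at h
  exact (prob_compl_eq_zero_iff₀ (nullMeasurableSet_le hX aemeasurable_const)).2 h

lemma ae_pos_of_cdf (hL : 2 ≤ L) (hcdf : ∀ τ, μ.real {ω | X ω ≤ τ} = cdiErrorCDF L B τ) :
    ∀ᵐ ω ∂μ, 0 < X ω := by
  have h := hcdf 0
  rw [cdiErrorCDF, if_neg (lt_irrefl _), if_pos (by positivity), zero_pow (by omega),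
    mul_zero, measureReal_eq_zero_iff] at h
  rw [ae_iff]
  simpa using h

/-- Layer cake: the mean is `∫₀^τ (1 - 2^B t^(L-1)) dt = τ - τ/L`, because `2^B τ^(L-1) = 1`. -/
lemma integral_of_cdf (hL : 2 ≤ L) (hX : AEMeasurable X μ)
    (hcdf : ∀ τ, μ.real {ω | X ω ≤ τ} = cdiErrorCDF L B τ) :
    ∫ ω, X ω ∂μ = ((L : ℝ) - 1) / L * (2 : ℝ) ^ (-((B : ℝ) / ((L : ℝ) - 1))) := by
  set τ := (2 : ℝ) ^ (-((B : ℝ) / ((L : ℝ) - 1))) with hτ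
  have hτ0 : 0 < τ := by positivity
  have hpos := ae_pos_of_cdf hL hcdf
  have hle := ae_le_of_cdf hL hX hcdf
  have hInt : Integrable X μ := by
    refine Integrable.of_bound hX.aestronglyMeasurable τ ?_
    filter_upwards [hpos, hle] with ω h1 h2
    rwa [Real.norm_of_nonneg h1.le]
  rw [hInt.integral_eq_integral_meas_lt (hpos.mono fun ω h => h.le)]
  have h1 : ∀ t ∈ Set.Ioi (0 : ℝ), μ.real {ω | t < X ω}
      = (Set.Ioc 0 τ).indicator (fun t => 1 - 2 ^ B * t ^ (L - 1)) t := by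
    intro t (ht : 0 < t)
    have h2 : {ω | t < X ω} = {ω | X ω ≤ t}ᶜ := by ext; simp
    have h3 : NullMeasurableSet {ω | X ω ≤ t} μ := nullMeasurableSet_le hX aemeasurable_const
    rw [h2, probReal_compl_eq_one_sub₀ h3, hcdf, cdiErrorCDF, if_neg (not_lt.2 ht.le), ← hτ]
    by_cases htτ : t ≤ τ
    · rw [if_pos htτ, Set.indicator_of_mem (show t ∈ Set.Ioc 0 τ from ⟨ht, htτ⟩)]
    · rw [if_neg htτ, Set.indicator_of_notMem (fun h => htτ h.2), sub_self]
  rw [setIntegral_congr_fun measurableSet_Ioi h1, setIntegral_indicator measurableSet_Ioc,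
    Set.inter_eq_right.2 Set.Ioc_subset_Ioi_self, ← intervalIntegral.integral_of_le hτ0.le,
    intervalIntegral.integral_sub (by simp) (by apply Continuous.intervalIntegrable; fun_prop),
    intervalIntegral.integral_const_mul, integral_pow]
  have h4 := two_rpow_pow hL B
  rw [← hτ] at h4
  have h5 : ((L - 1 : ℕ) : ℝ) + 1 = L := by rw [Nat.cast_sub (by omega)]; simp
  have hL0 : (L : ℝ) ≠ 0 := by positivity
  rw [h5, pow_succ, zero_pow (by omega)]
  simp only [intervalIntegral.integral_const, smul_eq_mul]
  rw [sub_zero, sub_zero, ← mul_div_assoc, ← mul_assoc, h4]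
  field_simp

end Quantizer

/-! ### Expansion of the outage probability. -/

section Outage

lemma abs_one_sub_exp_neg_sub_le {y : ℝ} (hy : 0 ≤ y) : |1 - Real.exp (-y) - y| ≤ y ^ 2 / 2 := by
  have h1 := Real.one_sub_le_exp_neg y
  have h2 := Real.quadratic_le_exp_of_nonneg hy
  have h3 : Real.exp (-y) ≤ 1 - y + y ^ 2 / 2 := by
    rw [Real.exp_neg, inv_le_iff_one_le_mul₀ (Real.exp_pos y)]
    have h4 : 0 ≤ 1 - y + y ^ 2 / 2 := by nlinarith [sq_nonneg (1 - y)]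
    -- The product equals `1 + y⁴/4`.
    calc (1 : ℝ) ≤ (1 - y + y ^ 2 / 2) * (1 + y + y ^ 2 / 2) := by
          nlinarith [sq_nonneg (y ^ 2)]
      _ ≤ _ := mul_le_mul_of_nonneg_left h2 h4
  rw [abs_le]
  constructor <;> linarith [sq_nonneg y]

variable {L : ℕ}

/-- The outage event in terms of the primary channel `q.2`, the cross channel `q.1.1.1`, its
quantized direction `q.1.1.2` and the secondary channel `q.1.2`. -/
def outageSet (L : ℕ) (a t c lam : ℝ) : Set (((CVec L × CVec L) × CVec L) × ℂ) :=
  {q | ‖perp q.1.1.2 q.1.2‖ ^ 2 ≤ a ∨ (t ≤ ‖q.2‖ ^ 2 ∧ ‖q.2‖ ^ 2 ≤ t +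
    c * (‖q.1.1.1‖ ^ 2 / lam) * leakRatio (shape q.1.1.1) q.1.1.2 q.1.2)}

lemma measurable_leakRatio : Measurable fun q : (CVec L × CVec L) × CVec L =>
    leakRatio (shape q.1.1) q.1.2 q.2 := by
  have h1 : Measurable fun q : (CVec L × CVec L) × CVec L => perp q.1.2 q.2 :=
    measurable_perp.comp (measurable_fst.snd.prodMk measurable_snd)
  have h2 : Measurable fun q : (CVec L × CVec L) × CVec L => shape q.1.1 :=
    measurable_shape.comp measurable_fst.fst
  exact ((h2.inner h1).norm.pow_const 2).div ((h1.norm.pow_const 2).pow_const 2)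

lemma measurableSet_outageSet (a t c lam : ℝ) : MeasurableSet (outageSet L a t c lam) := by
  have h1 : Measurable fun q : ((CVec L × CVec L) × CVec L) × ℂ => perp q.1.1.2 q.1.2 :=
    measurable_perp.comp (measurable_fst.fst.snd.prodMk measurable_fst.snd)
  have h2 : Measurable fun q : ((CVec L × CVec L) × CVec L) × ℂ =>
      leakRatio (shape q.1.1.1) q.1.1.2 q.1.2 := measurable_leakRatio.comp measurable_fst
  have h3 : Measurable fun q : ((CVec L × CVec L) × CVec L) × ℂ => ‖q.2‖ ^ 2 := by fun_prop
  have h4 : Measurable fun q : ((CVec L × CVec L) × CVec L) × ℂ => t +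
      c * (‖q.1.1.1‖ ^ 2 / lam) * leakRatio (shape q.1.1.1) q.1.1.2 q.1.2 := by fun_prop
  exact (measurableSet_le (h1.norm.pow_const 2) measurable_const).union
    ((measurableSet_le measurable_const h3).inter (measurableSet_le h3 h4))

/-- The interference leakage, restricted to the event that the secondary link is not in outage at
full power. -/
def leak (a : ℝ) (q : (CVec L × CVec L) × CVec L) : ℝ :=
  (Set.Ioi a).indicator (fun t => (t ^ 2)⁻¹) (‖perp q.1.2 q.2‖ ^ 2) *
    ‖inner ℂ (shape q.1.1) (perp q.1.2 q.2)‖ ^ 2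

lemma leak_nonneg (a : ℝ) (q : (CVec L × CVec L) × CVec L) : 0 ≤ leak a q :=
  mul_nonneg (Set.indicator_nonneg (fun t _ => by positivity) _) (by positivity)

lemma measurable_leak (a : ℝ) : Measurable (leak (L := L) a) := by
  have h1 : Measurable fun q : (CVec L × CVec L) × CVec L => perp q.1.2 q.2 :=
    measurable_perp.comp (measurable_fst.snd.prodMk measurable_snd)
  have h2 : Measurable fun q : (CVec L × CVec L) × CVec L => shape q.1.1 :=
    measurable_shape.comp measurable_fst.fst
  have hΦ : Measurable ((Set.Ioi a).indicator fun t : ℝ => (t ^ 2)⁻¹) :=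
    Measurable.indicator (by fun_prop) measurableSet_Ioi
  exact (hΦ.comp (h1.norm.pow_const 2)).mul ((h2.inner h1).norm.pow_const 2)

/-- Cauchy–Schwarz within the complement of `u` cancels one factor `‖perp u h‖²`; the truncation
bounds the other from below by `a`. -/
lemma leak_le {a τ : ℝ} (ha : 0 < a) {q : (CVec L × CVec L) × CVec L} (hu : ‖q.1.2‖ = 1)
    (hτ : ‖perp q.1.2 (shape q.1.1)‖ ^ 2 ≤ τ) : leak a q ≤ τ / a := by
  have hτ0 : 0 ≤ τ := le_trans (by positivity) hτ
  rw [leak]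
  by_cases h : ‖perp q.1.2 q.2‖ ^ 2 ∈ Set.Ioi a
  · have h' : a < ‖perp q.1.2 q.2‖ ^ 2 := h
    have hg := ha.trans h'
    rw [Set.indicator_of_mem h, inner_perp_right _ _ hu]
    have h1 : ‖inner ℂ (perp q.1.2 (shape q.1.1)) (perp q.1.2 q.2)‖ ^ 2
        ≤ τ * ‖perp q.1.2 q.2‖ ^ 2 := by
      refine (pow_le_pow_left₀ (norm_nonneg _) (norm_inner_le_norm _ _) 2).trans ?_
      rw [mul_pow]
      exact mul_le_mul_of_nonneg_right hτ hg.le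
    calc _ ≤ ((‖perp q.1.2 q.2‖ ^ 2) ^ 2)⁻¹ * (τ * ‖perp q.1.2 q.2‖ ^ 2) :=
          mul_le_mul_of_nonneg_left h1 (by positivity)
      _ = τ / ‖perp q.1.2 q.2‖ ^ 2 := by field_simp
      _ ≤ _ := div_le_div_of_nonneg_left hτ0 ha h'.le
  · rw [Set.indicator_of_notMem h, zero_mul]
    positivity

/-- Averaging the outage event over the primary channel. -/
lemma abs_real_outageSet_fiber_sub_le {a t c lam τ : ℝ} (ha : 0 < a) (ht : 0 ≤ t) (hc : 0 ≤ c)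
    (hlam : 0 < lam) {q : (CVec L × CVec L) × CVec L} (hu : ‖q.1.2‖ = 1)
    (hτ : ‖perp q.1.2 (shape q.1.1)‖ ^ 2 ≤ τ) :
    |(standardGaussian ℂ).real (Prod.mk q ⁻¹' outageSet L a t c lam) -
      (1 - (Set.Ioi a).indicator (fun _ => 1) (‖perp q.1.2 q.2‖ ^ 2) +
        Real.exp (-t) * c * (‖q.1.1‖ ^ 2 / lam * leak a q))|
      ≤ c ^ 2 * τ ^ 2 / (2 * a ^ 2) * (‖q.1.1‖ ^ 2 / lam) ^ 2 := by
  have hτ0 : 0 ≤ τ := le_trans (by positivity) hτ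
  by_cases h : ‖perp q.1.2 q.2‖ ^ 2 ∈ Set.Ioi a
  · have h' : ¬ ‖perp q.1.2 q.2‖ ^ 2 ≤ a := not_le.2 h
    have hleak : leakRatio (shape q.1.1) q.1.2 q.2 = leak a q := by
      rw [leak, leakRatio, Set.indicator_of_mem h, div_eq_inv_mul]
    set y := c * (‖q.1.1‖ ^ 2 / lam) * leak a q with hy
    have hl := leak_nonneg a q
    have hy0 : 0 ≤ y := by positivity
    have hfib : Prod.mk q ⁻¹' outageSet L a t c lam = {z | t ≤ ‖z‖ ^ 2 ∧ ‖z‖ ^ 2 ≤ t + y} := by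
      ext z
      simp only [outageSet, Set.mem_preimage, Set.mem_ofPred_eq, h', false_or, hleak, hy]
    rw [hfib, standardGaussian_real_annulus ht (by linarith), Set.indicator_of_mem h]
    have e : Real.exp (-t) - Real.exp (-(t + y)) - (1 - 1 + Real.exp (-t) * c *
        (‖q.1.1‖ ^ 2 / lam * leak a q)) = Real.exp (-t) * (1 - Real.exp (-y) - y) := by
      rw [neg_add, Real.exp_add, hy]; ring
    rw [e, abs_mul, abs_of_pos (Real.exp_pos _)]
    calc _ ≤ 1 * (y ^ 2 / 2) := mul_le_mul (Real.exp_le_one_iff.2 (by linarith))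
          (abs_one_sub_exp_neg_sub_le hy0) (abs_nonneg _) zero_le_one
      _ = c ^ 2 * (‖q.1.1‖ ^ 2 / lam) ^ 2 * leak a q ^ 2 / 2 := by rw [hy]; ring
      _ ≤ c ^ 2 * (‖q.1.1‖ ^ 2 / lam) ^ 2 * (τ / a) ^ 2 / 2 := by
          have := leak_le ha hu hτ
          gcongr
      _ = _ := by field_simp
  · have h' : ‖perp q.1.2 q.2‖ ^ 2 ≤ a := not_lt.1 h
    have hfib : Prod.mk q ⁻¹' outageSet L a t c lam = Set.univ := by
      ext z
      simp only [outageSet, Set.mem_preimage, Set.mem_ofPred_eq, h', true_or, Set.mem_univ]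
    rw [hfib, leak, Set.indicator_of_notMem h, Set.indicator_of_notMem h]
    simp
    positivity

/-- The outage probability as a function of the law `κ` of the cross channel and its quantized
direction, up to second order in the quantization error `τ`. -/
lemma abs_real_outageSet_sub_le (hL : 2 ≤ L) {κ : Measure (CVec L × CVec L)}
    [IsProbabilityMeasure κ] {a t c lam τ : ℝ} (ha : 0 < a) (ht : 0 ≤ t) (hc : 0 ≤ c)
    (hlam : 0 < lam) (hu : ∀ᵐ q ∂κ, ‖q.2‖ = 1) (hτ : ∀ᵐ q ∂κ, ‖perp q.2 (shape q.1)‖ ^ 2 ≤ τ)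
    (hg : Integrable (fun q => ‖q.1‖ ^ 2 / lam) κ)
    (hg2 : Integrable (fun q => (‖q.1‖ ^ 2 / lam) ^ 2) κ) :
    |((κ.prod (standardGaussian (CVec L))).prod (standardGaussian ℂ)).real
        (outageSet L a t c lam) -
      (1 - upperGamma ((L : ℝ) - 1) a / Real.Gamma ((L : ℝ) - 1) + Real.exp (-t) * c *
        ((∫ q, ‖q.1‖ ^ 2 / lam * ‖perp q.2 (shape q.1)‖ ^ 2 ∂κ) / ((L : ℝ) - 1) *
          (upperGamma ((L : ℝ) - 2) a / Real.Gamma ((L : ℝ) - 1))))|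
      ≤ c ^ 2 * τ ^ 2 / (2 * a ^ 2) * ∫ q, (‖q.1‖ ^ 2 / lam) ^ 2 ∂κ := by
  set ν := standardGaussian (CVec L) with hν
  set I : (CVec L × CVec L) × CVec L → ℝ :=
    fun q => (Set.Ioi a).indicator (fun _ => 1) (‖perp q.1.2 q.2‖ ^ 2) with hI
  set G : (CVec L × CVec L) × CVec L → ℝ := fun q => ‖q.1.1‖ ^ 2 / lam * leak a q with hG
  have hu' : ∀ᵐ q ∂κ.prod ν, ‖q.1.2‖ = 1 := Measure.quasiMeasurePreserving_fst.ae hu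
  have hτ' : ∀ᵐ q ∂κ.prod ν, ‖perp q.1.2 (shape q.1.1)‖ ^ 2 ≤ τ :=
    Measure.quasiMeasurePreserving_fst.ae hτ
  have hmp : Measurable fun q : (CVec L × CVec L) × CVec L => perp q.1.2 q.2 :=
    measurable_perp.comp (measurable_fst.snd.prodMk measurable_snd)
  have hIm : Measurable I :=
    (measurable_const.indicator measurableSet_Ioi).comp (hmp.norm.pow_const 2)
  have hIint : Integrable I (κ.prod ν) := by
    refine Integrable.of_bound hIm.aestronglyMeasurable 1 (Filter.Eventually.of_forall fun q => ?_)
    simp only [hI, Set.indicator_apply]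
    split_ifs <;> simp
  have hGint : Integrable G (κ.prod ν) := by
    refine ((hg.comp_fst ν).mul_const (τ / a)).mono'
      (((measurable_fst.fst.norm.pow_const 2).div_const lam).mul
        (measurable_leak a)).aestronglyMeasurable ?_
    filter_upwards [hu', hτ'] with q h1 h2
    have := leak_nonneg a q
    rw [Real.norm_of_nonneg (by positivity)]
    exact mul_le_mul_of_nonneg_left (leak_le ha h1 h2) (by positivity)
  have hS := measurableSet_outageSet (L := L) a t c lam
  have hfib : ((κ.prod ν).prod (standardGaussian ℂ)).real (outageSet L a t c lam)
      = ∫ q, (standardGaussian ℂ).real (Prod.mk q ⁻¹' outageSet L a t c lam) ∂κ.prod ν := by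
    rw [← integral_indicator_one hS, integral_prod ((outageSet L a t c lam).indicator 1)
      ((integrable_const (1 : ℝ)).indicator hS)]
    refine integral_congr_ae (Filter.Eventually.of_forall fun q => ?_)
    simp only
    rw [← integral_indicator_one (measurable_prodMk_left hS)]
    rfl
  have hfibint : Integrable (fun q => (standardGaussian ℂ).real
      (Prod.mk q ⁻¹' outageSet L a t c lam)) (κ.prod ν) := by
    refine Integrable.of_bound
      (measurable_measure_prodMk_left hS).ennreal_toReal.aestronglyMeasurable 1
      (Filter.Eventually.of_forall fun q => ?_)
    rw [Real.norm_of_nonneg measureReal_nonneg]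
    exact measureReal_le_one
  have hIval : ∫ q, I q ∂κ.prod ν
      = upperGamma ((L : ℝ) - 1) a / Real.Gamma ((L : ℝ) - 1) := by
    rw [integral_prod _ hIint]
    have : ∀ᵐ q ∂κ, ∫ h, I (q, h) ∂ν = upperGamma ((L : ℝ) - 1) a / Real.Gamma ((L : ℝ) - 1) := by
      filter_upwards [hu] with q hq
      exact real_norm_perp_sq_gt hL hq ha
    rw [integral_congr_ae this]
    simp
  -- The secondary channel is averaged first, with the cross channel and its quantized direction
  -- frozen.
  have hGval : ∫ q, G q ∂κ.prod ν
      = (∫ q, ‖q.1‖ ^ 2 / lam * ‖perp q.2 (shape q.1)‖ ^ 2 ∂κ) / ((L : ℝ) - 1) *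
          (upperGamma ((L : ℝ) - 2) a / Real.Gamma ((L : ℝ) - 1)) := by
    rw [integral_prod _ hGint, ← integral_div, ← integral_mul_const]
    refine integral_congr_ae ?_
    filter_upwards [hu] with q hq
    simp only [hG]
    rw [integral_const_mul]
    simp only [leak]
    rw [integral_inner_perp hL hq ha]
    ring
  have hJint : Integrable (fun q => 1 - I q) (κ.prod ν) := (integrable_const _).sub hIint
  have hHint : Integrable (fun q => 1 - I q + Real.exp (-t) * c * G q) (κ.prod ν) :=
    hJint.add (hGint.const_mul _)
  have hmain : ∫ q, (1 - I q + Real.exp (-t) * c * G q) ∂κ.prod ν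
      = 1 - upperGamma ((L : ℝ) - 1) a / Real.Gamma ((L : ℝ) - 1) + Real.exp (-t) * c *
        ((∫ q, ‖q.1‖ ^ 2 / lam * ‖perp q.2 (shape q.1)‖ ^ 2 ∂κ) / ((L : ℝ) - 1) *
          (upperGamma ((L : ℝ) - 2) a / Real.Gamma ((L : ℝ) - 1))) := by
    rw [integral_add hJint (hGint.const_mul _),
      integral_sub (integrable_const _) hIint, integral_const_mul, hIval, hGval]
    simp
  rw [hfib, ← hmain, ← integral_sub hfibint hHint]
  have hb : ∫ q, (‖q.1.1‖ ^ 2 / lam) ^ 2 ∂κ.prod ν = ∫ q, (‖q.1‖ ^ 2 / lam) ^ 2 ∂κ := by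
    rw [integral_prod _ (hg2.comp_fst ν)]
    simp
  rw [← hb, ← integral_const_mul]
  refine (abs_integral_le_integral_abs).trans (integral_mono_of_nonneg
    (Filter.Eventually.of_forall fun q => abs_nonneg _) ((hg2.comp_fst ν).const_mul _) ?_)
  filter_upwards [hu', hτ'] with q h1 h2
  exact abs_real_outageSet_fiber_sub_le ha ht hc hlam h1 h2

end Outage

/-! ### The system model: independence and null events. -/

section System

variable {Ω : Type*} [MeasurableSpace Ω] {μ : Measure Ω} [IsProbabilityMeasure μ] {p : Params}
  {B : ℕ} {hp : Ω → ℂ} {hx hs sHat f : Ω → CVec p.L}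

namespace IsOCBFeedforward

/-- The joint law of the channels and of the quantized direction is a product law. -/
lemma map_channels (h : IsOCBFeedforward μ p B hp hx hs sHat f) :
    μ.map (fun ω => (((hx ω, sHat ω), hs ω), hp ω))
      = ((μ.map fun ω => (hx ω, sHat ω)).prod (standardGaussian (CVec p.L))).prod
        (standardGaussian ℂ) := by
  have mx := h.law_hx.aemeasurable
  have ms := h.law_hs.aemeasurable
  have mq := h.aemeasurable_sHat
  have mp := h.law_hp.aemeasurable
  have ls : μ.map hs = standardGaussian (CVec p.L) := by
    simpa using h.law_hs.map_smul one_pos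
  rw [(indepFun_iff_map_prod_eq_prod_map_map ((mx.prodMk mq).prodMk ms) mp).1 h.indep_hp,
    (indepFun_iff_map_prod_eq_prod_map_map (mx.prodMk mq) ms).1 h.indep_hs, ls,
    h.law_hp.map_eq, complexGaussian_one]

lemma integral_gain (h : IsOCBFeedforward μ p B hp hx hs sHat f) (hL : 1 ≤ p.L)
    (hlam : 0 < p.lam) (k : ℕ) : Integrable (fun ω => (‖hx ω‖ ^ 2 / p.lam) ^ k) μ ∧
      ∫ ω, (‖hx ω‖ ^ 2 / p.lam) ^ k ∂μ = Real.Gamma (p.L + k) / Real.Gamma p.L := by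
  have mx := h.law_hx.aemeasurable
  have e : ∀ ω, (‖hx ω‖ ^ 2 / p.lam) ^ k = (‖(√p.lam)⁻¹ • hx ω‖ ^ 2) ^ k := by
    intro ω
    rw [norm_smul, mul_pow, norm_inv, Real.norm_eq_abs, inv_pow, sq_abs, Real.sq_sqrt hlam.le,
      div_eq_inv_mul]
  have hm : AEMeasurable (fun ω => (√p.lam)⁻¹ • hx ω) μ := by fun_prop
  have hc : Continuous fun x : CVec p.L => (‖x‖ ^ 2) ^ k := by fun_prop
  have key := integral_norm_pow_standardGaussian hL k
  rw [← h.law_hx.map_smul hlam, integrable_map_measure hc.aestronglyMeasurable hm,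
    integral_map hm hc.aestronglyMeasurable] at key
  simp only [e]
  exact key

lemma ae_cross_ne_zero (h : IsOCBFeedforward μ p B hp hx hs sHat f) (hL : 1 ≤ p.L)
    (hlam : 0 < p.lam) : ∀ᵐ ω ∂μ, hx ω ≠ 0 := by
  have := nontrivial_CVec hL
  obtain ⟨w, hw⟩ := exists_ne (0 : CVec p.L)
  have h1 := ae_inner_ne_zero hw
  rw [← h.law_hx.map_smul hlam] at h1
  have hm := h.law_hx.aemeasurable
  filter_upwards [ae_of_ae_map (f := fun ω => (√p.lam)⁻¹ • hx ω) (by fun_prop) h1] with ω hω h0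
  simp [h0] at hω

lemma ae_cdiError_eq (h : IsOCBFeedforward μ p B hp hx hs sHat f) (hL : 1 ≤ p.L)
    (hlam : 0 < p.lam) :
    ∀ᵐ ω ∂μ, cdiError (sHat ω) (shape (hx ω)) = ‖perp (sHat ω) (shape (hx ω))‖ ^ 2 := by
  filter_upwards [h.norm_sHat, h.ae_cross_ne_zero hL hlam] with ω h1 h2
  exact cdiError_eq h1 (norm_shape h2)

lemma aemeasurable_cdiError (h : IsOCBFeedforward μ p B hp hx hs sHat f) :
    AEMeasurable (fun ω => cdiError (sHat ω) (shape (hx ω))) μ := by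
  have m1 := measurable_shape.comp_aemeasurable h.law_hx.aemeasurable
  exact ((h.aemeasurable_sHat.inner m1).norm.pow_const 2).const_sub 1

lemma integral_gain_mul_cdiError (h : IsOCBFeedforward μ p B hp hx hs sHat f) (hL : 2 ≤ p.L)
    (hlam : 0 < p.lam) : ∫ ω, ‖hx ω‖ ^ 2 / p.lam * ‖perp (sHat ω) (shape (hx ω))‖ ^ 2 ∂μ
      = ((p.L : ℝ) - 1) * (2 : ℝ) ^ (-((B : ℝ) / ((p.L : ℝ) - 1))) := by
  have hL0 : (0 : ℝ) < p.L := by exact_mod_cast (by omega : 0 < p.L)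
  -- The error depends only on the direction and its quantization, so the mean of the product is `L`
  -- times the mean error `(L-1)τ/L`.
  have hind : IndepFun (fun ω => ‖hx ω‖ ^ 2 / p.lam)
      (fun ω => cdiError (sHat ω) (shape (hx ω))) μ :=
    h.indep_gain.comp (φ := fun r : ℝ => r ^ 2 / p.lam)
      (ψ := fun q : CVec p.L × CVec p.L => cdiError q.2 q.1) (by fun_prop)
      (by unfold cdiError; fun_prop)
  have h1 : ∫ ω, ‖hx ω‖ ^ 2 / p.lam * ‖perp (sHat ω) (shape (hx ω))‖ ^ 2 ∂μ
      = ∫ ω, ‖hx ω‖ ^ 2 / p.lam * cdiError (sHat ω) (shape (hx ω)) ∂μ := by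
    refine integral_congr_ae ?_
    filter_upwards [h.ae_cdiError_eq (by omega) hlam] with ω hω
    rw [hω]
  have hg := (h.integral_gain (by omega) hlam 1).2
  simp only [pow_one, Nat.cast_one, Real.Gamma_add_one hL0.ne'] at hg
  rw [h1, hind.integral_fun_mul_eq_mul_integral
    ((h.law_hx.aemeasurable.norm.pow_const 2).div_const _).aestronglyMeasurable
    h.aemeasurable_cdiError.aestronglyMeasurable, hg,
    integral_of_cdf hL h.aemeasurable_cdiError h.cdf_cdiError]
  have := (Real.Gamma_pos_of_pos hL0).ne'
  field_simp

/-- Almost surely `ε > 0`, so `perp ŝ_x s_x ≠ 0`. With these vectors fixed, the independent Gaussian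
`h_s` avoids the null hyperplane, and Fubini concludes. -/
lemma ae_inner_ne_zero (h : IsOCBFeedforward μ p B hp hx hs sHat f) (hL : 2 ≤ p.L)
    (hlam : 0 < p.lam) : ∀ᵐ ω ∂μ, inner ℂ (shape (hx ω)) (perp (sHat ω) (hs ω)) ≠ 0 := by
  have mx := h.law_hx.aemeasurable
  have ms := h.law_hs.aemeasurable
  have mq := h.aemeasurable_sHat
  have h1 : Measurable fun q : (CVec p.L × CVec p.L) × CVec p.L => perp q.1.2 q.2 :=
    measurable_perp.comp (measurable_fst.snd.prodMk measurable_snd)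
  have h2 : Measurable fun q : (CVec p.L × CVec p.L) × CVec p.L => shape q.1.1 :=
    measurable_shape.comp measurable_fst.fst
  have hset : MeasurableSet {q : (CVec p.L × CVec p.L) × CVec p.L |
      inner ℂ (shape q.1.1) (perp q.1.2 q.2) ≠ 0} :=
    (h2.inner h1) (measurableSet_singleton (0 : ℂ)).compl
  have hset2 : MeasurableSet {q : CVec p.L × CVec p.L | ‖q.2‖ = 1 ∧ perp q.2 (shape q.1) ≠ 0} :=
    (measurable_snd.norm (measurableSet_singleton 1)).inter
      ((measurable_perp.comp (measurable_snd.prodMk (measurable_shape.comp measurable_fst)))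
        (measurableSet_singleton (0 : CVec p.L)).compl)
  have ls : μ.map hs = standardGaussian (CVec p.L) := by
    simpa using h.law_hs.map_smul one_pos
  have hlaw := (indepFun_iff_map_prod_eq_prod_map_map (mx.prodMk mq) ms).1 h.indep_hs
  have : IsProbabilityMeasure (μ.map fun ω => (hx ω, sHat ω)) :=
    Measure.isProbabilityMeasure_map (mx.prodMk mq)
  have hae : ∀ᵐ q ∂(μ.map fun ω => (hx ω, sHat ω)), ‖q.2‖ = 1 ∧ perp q.2 (shape q.1) ≠ 0 := by
    rw [ae_map_iff (mx.prodMk mq) hset2]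
    filter_upwards [h.norm_sHat, h.ae_cdiError_eq (by omega) hlam,
      ae_pos_of_cdf hL h.cdf_cdiError] with ω e1 e2 e3
    refine ⟨e1, fun e4 => ?_⟩
    rw [e2, e4] at e3
    simp at e3
  refine ae_of_ae_map ((mx.prodMk mq).prodMk ms)
    (p := fun q => inner ℂ (shape q.1.1) (perp q.1.2 q.2) ≠ 0) ?_
  rw [hlaw, ls, Measure.ae_prod_iff_ae_ae hset]
  filter_upwards [hae] with q hq
  exact ae_inner_perp_ne_zero hq.1 hq.2

/-- The beamformer enters only through an almost sure equivalence of events, so no measurability of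
`f` is needed. -/
lemma outageProb_eq (h : IsOCBFeedforward μ p B hp hx hs sHat f) (hL : 2 ≤ p.L)
    (hlam : 0 < p.lam) (hthetaP : 0 < p.thetaP) (hPp : 0 < p.Pp) (hPmax : 0 < p.Pmax)
    (hnoise : 0 < p.noise) : outageProb μ p hs f =
      (((μ.map fun ω => (hx ω, sHat ω)).prod (standardGaussian (CVec p.L))).prod
        (standardGaussian ℂ)).real (outageSet p.L (p.thetaS / p.gammaMax)
          (p.thetaP / p.gammaP) (p.thetaP / p.gammaP * p.thetaS * p.lam) p.lam) := by
  rw [← h.map_channels, map_measureReal_apply_of_aemeasurable (((h.law_hx.aemeasurable.prodMk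
    h.aemeasurable_sHat).prodMk h.law_hs.aemeasurable).prodMk h.law_hp.aemeasurable)
    (measurableSet_outageSet _ _ _ _)]
  refine measureReal_congr ?_
  filter_upwards [h.norm_sHat, h.ae_inner_ne_zero hL hlam, h.beamformer] with ω h1 h2 h3
  exact propext (snrS_le_iff hlam hthetaP hPp hPmax hnoise h1 h2 h3)

end IsOCBFeedforward

end System

end CognitiveBeamforming

end

/-! ### Assembly of the theorem. -/

open CognitiveBeamforming

theorem mainTheorem2 (p : CognitiveBeamforming.Params) (hL : 2 ≤ p.L)
    (hlam : 0 < p.lam) (hlam1 : p.lam < 1) (hthetaP : 0 < p.thetaP) (hthetaS : 0 < p.thetaS)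
    (hPp : 0 < p.Pp) (hPmax : 0 < p.Pmax) (hnoise : 0 < p.noise) :
    ∃ C : ℝ, ∀ (B : ℕ) (Ω : Type*) [MeasurableSpace Ω] (μ : Measure Ω) [IsProbabilityMeasure μ]
      (hp : Ω → ℂ) (hx hs sHat f : Ω → CognitiveBeamforming.CVec p.L),
      CognitiveBeamforming.IsOCBFeedforward μ p B hp hx hs sHat f →
      |CognitiveBeamforming.outageProb μ p hs f -
          (1 - CognitiveBeamforming.upperGamma ((p.L : ℝ) - 1) (p.thetaS / p.gammaMax) /
              Real.Gamma ((p.L : ℝ) - 1) +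
            p.phi / ((p.L : ℝ) - 1) * (2 : ℝ) ^ (-((B : ℝ) / ((p.L : ℝ) - 1))))| ≤
        C * (2 : ℝ) ^ (-(2 * (B : ℝ) / ((p.L : ℝ) - 1))) := by
  have hgP : 0 < p.gammaP := div_pos hPp hnoise
  have hgM : 0 < p.gammaMax := div_pos hPmax hnoise
  have hL1 : (0 : ℝ) < (p.L : ℝ) - 1 := by
    have : (2 : ℝ) ≤ p.L := by exact_mod_cast hL
    linarith
  -- The remainder is at most `E[y²]/2` on `‖h⊥‖² > a`, where `y ≤ c g_x τ / a` with `c = t θ_s λ`;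
  -- the Gamma quotient is `E[g_x²]`.
  refine ⟨(p.thetaP / p.gammaP * p.thetaS * p.lam) ^ 2 / (2 * (p.thetaS / p.gammaMax) ^ 2) *
    (Real.Gamma (p.L + (2 : ℕ)) / Real.Gamma p.L), fun B Ω _ μ _ hp hx hs sHat f h => ?_⟩
  have mκ : AEMeasurable (fun ω => (hx ω, sHat ω)) μ :=
    h.law_hx.aemeasurable.prodMk h.aemeasurable_sHat
  have : IsProbabilityMeasure (μ.map fun ω => (hx ω, sHat ω)) :=
    Measure.isProbabilityMeasure_map mκ
  set τ := (2 : ℝ) ^ (-((B : ℝ) / ((p.L : ℝ) - 1))) with hτ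
  have hτ2 : (2 : ℝ) ^ (-(2 * (B : ℝ) / ((p.L : ℝ) - 1))) = τ ^ 2 := by
    rw [hτ, ← Real.rpow_mul_natCast (by norm_num)]
    congr 1
    push_cast
    ring
  have mperp : Measurable fun q : CVec p.L × CVec p.L => ‖perp q.2 (shape q.1)‖ ^ 2 :=
    (measurable_perp.comp
      (measurable_snd.prodMk (measurable_shape.comp measurable_fst))).norm.pow_const 2
  have mgain : Measurable fun q : CVec p.L × CVec p.L => ‖q.1‖ ^ 2 / p.lam := by fun_prop
  have hu : ∀ᵐ q ∂(μ.map fun ω => (hx ω, sHat ω)), ‖q.2‖ = 1 := by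
    exact (ae_map_iff mκ (measurable_snd.norm (measurableSet_singleton 1))).2 h.norm_sHat
  have hτle : ∀ᵐ q ∂(μ.map fun ω => (hx ω, sHat ω)), ‖perp q.2 (shape q.1)‖ ^ 2 ≤ τ := by
    rw [ae_map_iff mκ (measurableSet_le mperp measurable_const)]
    filter_upwards [h.ae_cdiError_eq (by omega) hlam,
      ae_le_of_cdf hL h.aemeasurable_cdiError h.cdf_cdiError] with ω h1 h2
    rwa [h1] at h2
  have hg1 := h.integral_gain (by omega) hlam 1
  have hg2 := h.integral_gain (by omega) hlam 2
  simp only [pow_one] at hg1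
  have hb := abs_real_outageSet_sub_le (κ := μ.map fun ω => (hx ω, sHat ω)) hL
    (div_pos hthetaS hgM) (div_pos hthetaP hgP).le
    (mul_pos (mul_pos (div_pos hthetaP hgP) hthetaS) hlam).le hlam hu hτle
    ((integrable_map_measure mgain.aestronglyMeasurable mκ).2 hg1.1)
    ((integrable_map_measure (mgain.pow_const 2).aestronglyMeasurable mκ).2 hg2.1)
  rw [← h.outageProb_eq hL hlam hthetaP hPp hPmax hnoise,
    integral_map (f := fun q => ‖q.1‖ ^ 2 / p.lam * ‖perp q.2 (shape q.1)‖ ^ 2) mκ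
      (mgain.mul mperp).aestronglyMeasurable,
    integral_map (f := fun q => (‖q.1‖ ^ 2 / p.lam) ^ 2) mκ (mgain.pow_const 2).aestronglyMeasurable,
    h.integral_gain_mul_cdiError hL hlam, hg2.2] at hb
  rw [hτ2]
  convert hb using 1
  · congr 3
    rw [Params.phi, ← hτ]
    field_simp
  · ring
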